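/- Let $L^2$ and $L^\infty$ be the Lebesgue spaces of the unit circle $\mathbb{T}$ with normalized Lebesgue measure, let $H^2\subset L^2$ be the Hardy space of functions whose Fourier coefficients of negative index vanish, and let $H^\infty=L^\infty\cap H^2$. An inner function is an element of $H^\infty$ that is unimodular almost everywhere on $\mathbb{T}$. For an inner function $\theta$ let $K_\theta=H^2\ominus\theta H^2$ be the model space, $P_\theta:L^2\to K_\theta$ the orthogonal projection, and $S_\theta:K_\theta\to K_\theta$, $S_\theta h=P_\theta(zh)$, the compressed shift. For an inner function $\eta$ let $P_{\eta H^2}:L^2\to\eta H^2$ be the orthogonal projection and $\mathcal{S}_{(\eta)}:\eta H^2\to\eta H^2$, $\mathcal{S}_{(\eta)}h=P_{\eta H^2}(zh)$, the compression of the shift to $\eta H^2$. For $\phi\in L^\infty$ let $\mathcal{T}_\phi:\eta H^2\to K_\theta$, $\mathcal{T}_\phi h=P_\theta(\phi h)$, be the restricted Toeplitz operator with symbol $\phi$. Theorem. Let $\eta$ and $\theta$ be two inner functions and let $A:\eta H^2\to K_\theta$ be a bounded linear operator. Then $A\,\mathcal{S}_{(\eta)}=S_\theta A$ if and only if $A=\mathcal{T}_\phi$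 for some $\phi\in\bar\eta H^\infty=\{\bar\eta\psi:\psi\in H^\infty\}$. -/

import Mathlib

noncomputable section

open MeasureTheory AddCircle
open scoped ENNReal

namespace RestrictedToeplitz

/-- `L²` of the unit circle with normalized Lebesgue measure. The circle is parametrized by
`x ↦ exp (2 π i x)`, `x ∈ ℝ / ℤ`, so that the coordinate function `z` is `fourier 1`. -/
abbrev L2 : Type := Lp ℂ 2 (haarAddCircle : Measure UnitAddCircle)

/-- `L^∞` of the unit circle. -/
abbrev LInf : Type := Lp ℂ ∞ (haarAddCircle : Measure UnitAddCircle)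

/-- The multiplication operator `M_φ : L² → L²`, `f ↦ φ f`, with symbol `φ ∈ L^∞`. -/
def mulOp (φ : LInf) : L2 →L[ℂ] L2 :=
  (ContinuousLinearMap.mul ℂ ℂ).holderL haarAddCircle ∞ 2 2 φ

theorem coeFn_mulOp (φ : LInf) (f : L2) :
    mulOp φ f =ᵐ[haarAddCircle] fun x => φ x * f x :=
  (ContinuousLinearMap.mul ℂ ℂ).coeFn_holder φ f

/-- Multiplication by the coordinate function `z`; on `H²` this is the shift `S`. -/
def mulZ : L2 →L[ℂ] L2 := mulOp (fourierLp ∞ 1)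

/-- The Hardy space `H²`: the functions in `L²` whose Fourier coefficients of negative index
vanish. -/
def H2 : Submodule ℂ L2 where
  carrier := {f | ∀ n : ℤ, n < 0 → fourierCoeff f n = 0}
  zero_mem' := fun n _ => by
    rw [← fourierBasis_repr]; simp
  add_mem' := fun {f g} hf hg n hn => by
    have hf' := hf n hn
    have hg' := hg n hn
    rw [← fourierBasis_repr] at hf' hg' ⊢
    simp [hf', hg']
  smul_mem' := fun c f hf n hn => by
    have hf' := hf n hn
    rw [← fourierBasis_repr] at hf' ⊢
    simp [hf']

theorem isClosed_H2 : IsClosed (H2 : Set L2) := by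
  have h : (H2 : Set L2) = ⋂ n : ℤ, ⋂ _ : n < 0,
      {f : L2 | inner ℂ (fourierBasis (T := 1) n) f = 0} := by
    ext f
    simp only [Set.mem_iInter, Set.mem_ofPred_eq, ← HilbertBasis.repr_apply_apply,
      fourierBasis_repr]
    rfl
  rw [h]
  exact isClosed_iInter fun n => isClosed_iInter fun _ =>
    isClosed_eq (by fun_prop) continuous_const

instance : CompleteSpace H2 := isClosed_H2.completeSpace_coe

/-- `H^∞ = L^∞ ∩ H²`: the functions in `L^∞` whose Fourier coefficients of negative index
vanish. -/
def HInf : Set LInf := {φ | ∀ n : ℤ, n < 0 → fourierCoeff φ n = 0}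

/-- An inner function: an element of `H^∞` that is unimodular almost everywhere on the circle. -/
structure InnerFunction where
  toLInf : LInf
  mem_HInf : toLInf ∈ HInf
  norm_eq_one : ∀ᵐ x ∂(haarAddCircle : Measure UnitAddCircle), ‖toLInf x‖ = 1

instance : Coe InnerFunction LInf := ⟨InnerFunction.toLInf⟩

/-- The Beurling subspace `θ H²`. -/
def beurling (θ : InnerFunction) : Submodule ℂ L2 := H2.map (mulOp θ).toLinearMap

/-- The model space `K_θ`, the orthogonal complement of `θ H²` in `H²`. -/
def modelSpace (θ : InnerFunction) : Submodule ℂ L2 := H2 ⊓ (beurling θ)ᗮ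

theorem norm_mulOp (θ : InnerFunction) (f : L2) : ‖mulOp θ f‖ = ‖f‖ := by
  rw [Lp.norm_def, Lp.norm_def]
  congr 1
  apply eLpNorm_congr_norm_ae
  filter_upwards [coeFn_mulOp θ f, θ.norm_eq_one] with x hx h1
  rw [hx, norm_mul, h1, one_mul]

instance (θ : InnerFunction) : CompleteSpace (beurling θ) := by
  have hi : Isometry (mulOp θ) := AddMonoidHomClass.isometry_of_norm _ (norm_mulOp θ)
  have hc : IsClosed ((beurling θ : Submodule ℂ L2) : Set L2) := by
    have : ((beurling θ : Submodule ℂ L2) : Set L2) = mulOp θ '' (H2 : Set L2) := rfl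
    rw [this]
    exact hi.isClosedEmbedding.isClosedMap _ isClosed_H2
  exact hc.completeSpace_coe

instance (θ : InnerFunction) : CompleteSpace (modelSpace θ) := by
  have hc : IsClosed ((modelSpace θ : Submodule ℂ L2) : Set L2) :=
    isClosed_H2.inter (Submodule.isClosed_orthogonal _)
  exact hc.completeSpace_coe

/-- The compression `𝒮_(η) = P_{η H²} S|_{η H²}` of the shift to `η H²`. -/
def beurlingShift (η : InnerFunction) : beurling η →L[ℂ] beurling η :=
  (beurling η).orthogonalProjectionOnto ∘L mulZ ∘L (beurling η).subtypeL

/-- The compressed shift `S_θ = P_θ S|_{K_θ}` on the model space `K_θ`, where `P_θ` is the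
orthogonal projection of `L²` onto `K_θ`. -/
def compressedShift (θ : InnerFunction) : modelSpace θ →L[ℂ] modelSpace θ :=
  (modelSpace θ).orthogonalProjectionOnto ∘L mulZ ∘L (modelSpace θ).subtypeL

/-- The restricted Toeplitz operator `𝒯_φ : η H² → K_θ`, `h ↦ P_θ (φ h)`, with symbol
`φ ∈ L^∞`. -/
def restrictedToeplitz (η θ : InnerFunction) (φ : LInf) : beurling η →L[ℂ] modelSpace θ :=
  (modelSpace θ).orthogonalProjectionOnto ∘L mulOp φ ∘L (beurling η).subtypeL

/-- The set `η̄ H^∞ = {η̄ ψ : ψ ∈ H^∞}`, a subset of `L^∞`; here `star` is pointwise complex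
conjugation and `•` is pointwise multiplication. -/
def conjMulHInf (η : InnerFunction) : Set LInf :=
  {φ | ∃ ψ ∈ HInf, φ = star (η : LInf) • ψ}

end RestrictedToeplitz

end

/-!
The proof turns the statement into Sarason's lifting theorem for `H²` and proves that by duality,
along the lines of Nehari's theorem.

Since `h ↦ η h` is an isometry of `H²` onto `η H²` commuting with multiplication by `z`, the
operator `A` is carried to `B f = A (η f)` on `H²`. As `H² = K_θ ⊕ θ H²`, the intertwining
relation says that `B (z f) - z B f ∈ θ H²` for `f ∈ H²`, and `A` has symbol `η̄ ψ` with `ψ ∈ H^∞`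
as soon as `ψ f - B f ∈ θ H²` for all `f ∈ H²`. One direction follows at once; the other is the
construction of `ψ` in `exists_mulOp_sub_mem_beurling`.

Consider the functional `ℓ(h) = ∫ z θ̄ B h` on `H^∞`. Since `∫ z θ̄ k = 0` for `k ∈ θ H²`,
changing `B h` by an element of `θ H²` does not affect it, so the intertwining relation gives `ℓ(φ
g) = ∫ z θ̄ B(φ) g` (`inner_map_mulOp`), and hence `|ℓ(φ g)| ≤ ‖B‖ ‖φ‖₂ ‖g‖₂`. Given `h ∈ H^∞` and
`ε > 0`, Szegő's theorem (`exists_szego_factorization`) yields an invertible `w ∈ H^∞` with `|w|²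
= |h| + ε`; taking `φ = w` and `g = h / w` gives `|ℓ(h)| ≤ ‖B‖ (‖h‖₁ + ε)`, thus `|ℓ(h)| ≤ ‖B‖
‖h‖₁` (`norm_inner_map_le`). By Hahn–Banach, `ℓ` extends to `L²` with the same bound, and the
extension is integration against a bounded function `χ` (`exists_inner_toL2_eq`). Put `ψ = θ z̄
χ`. Comparing `ℓ(zⁿ zᵐ) = ∫ zⁿ⁺¹ θ̄ ψ zᵐ` with `ℓ(zⁿ zᵐ) = ∫ zⁿ⁺¹ θ̄ B(zᵐ)` shows that `θ̄ (ψ zᵐ -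
B zᵐ)` has no Fourier coefficients of negative index, which is the claim; the case `m = 0` gives
`ψ ∈ H^∞`.

Szegő's theorem is proved by projection in `L²`: if `√q g` is the component of `√q` orthogonal to
`√q z H²`, then `q |g|²` is orthogonal to all `zⁿ`, `n ≠ 0`, hence constant, and both `g` and the
conjugate of `q g` lie in `H²`; up to constant factors the latter is `w`, and `g` is `1 / w`.
-/

noncomputable section

open MeasureTheory AddCircle
open scoped ENNReal ComplexConjugate

namespace RestrictedToeplitz

/-! ### Multiplication operators and the Hardy space -/

/-- Normalized Lebesgue measure on the circle. -/
local notation "𝓂" => (haarAddCircle : Measure UnitAddCircle)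

/-- The monomial `zⁿ`, as an element of `L²`. -/
local notation "𝐞" => fourierLp (T := 1) 2

theorem fourierCoeff_eq_inner (f : L2) (n : ℤ) : fourierCoeff f n = inner ℂ (𝐞 n) f := by
  rw [← fourierBasis_repr, HilbertBasis.repr_apply_apply, coe_fourierBasis]

theorem mem_H2_iff {f : L2} : f ∈ H2 ↔ ∀ n : ℤ, n < 0 → inner ℂ (𝐞 n) f = 0 := by
  simp only [← fourierCoeff_eq_inner]
  rfl

theorem inner_eq_integral (f g : L2) : inner ℂ f g = ∫ x, g x * conj (f x) ∂𝓂 := by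
  rw [L2.inner_def]
  rfl

theorem mulOp_eq_of_ae {φ : LInf} {f g : L2} (h : ∀ᵐ x ∂𝓂, φ x * f x = g x) :
    mulOp φ f = g :=
  Lp.ext ((coeFn_mulOp φ f).trans h)

theorem mulOp_comm (φ ψ : LInf) (f : L2) : mulOp φ (mulOp ψ f) = mulOp ψ (mulOp φ f) := by
  apply mulOp_eq_of_ae
  filter_upwards [coeFn_mulOp ψ f, coeFn_mulOp φ f, coeFn_mulOp ψ (mulOp φ f)] with x h1 h2 h3
  rw [h1, h3, h2]
  ring

theorem mulOp_smul (φ ψ : LInf) (f : L2) :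
    mulOp (φ • ψ : LInf) f = mulOp φ (mulOp ψ f) := by
  apply mulOp_eq_of_ae
  filter_upwards [coeFn_mulOp ψ f, coeFn_mulOp φ (mulOp ψ f),
    Lp.coeFn_lpSMul (r := ∞) φ ψ] with x h1 h2 h3
  rw [h2, h1, h3, Pi.smul_apply', smul_eq_mul]
  ring

theorem inner_mulOp_right (φ : LInf) (f g : L2) :
    inner ℂ f (mulOp φ g) = inner ℂ (mulOp (star φ) f) g := by
  rw [inner_eq_integral, inner_eq_integral]
  apply integral_congr_ae
  filter_upwards [coeFn_mulOp φ g, coeFn_mulOp (star φ) f, Lp.coeFn_star φ] with x h1 h2 h3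
  rw [h1, h2, h3]
  simp
  ring

theorem mulOp_star_mulOp (θ : InnerFunction) (f : L2) :
    mulOp (star (θ : LInf)) (mulOp θ f) = f := by
  apply mulOp_eq_of_ae
  filter_upwards [coeFn_mulOp θ f, Lp.coeFn_star (θ : LInf), θ.norm_eq_one] with x h1 h2 h3
  rw [h1, h2, ← mul_assoc, Pi.star_apply, RCLike.star_def, RCLike.conj_mul, h3]
  simp

theorem mulOp_mulOp_star (θ : InnerFunction) (f : L2) :
    mulOp θ (mulOp (star (θ : LInf)) f) = f := by
  rw [mulOp_comm, mulOp_star_mulOp]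

theorem inner_mulOp_mulOp (θ : InnerFunction) (f g : L2) :
    inner ℂ (mulOp θ f) (mulOp θ g) = inner ℂ f g := by
  rw [inner_mulOp_right, mulOp_star_mulOp]

/-- Multiplication by `zⁿ`, for an integer `n`. -/
def mulZPow (n : ℤ) : L2 →L[ℂ] L2 := mulOp (fourierLp ∞ n)

theorem mulZ_eq : mulZ = mulZPow 1 := rfl

theorem coeFn_mulZPow (n : ℤ) (f : L2) :
    mulZPow n f =ᵐ[𝓂] fun x => fourier n x * f x := by
  filter_upwards [coeFn_mulOp (fourierLp ∞ n) f, coeFn_fourierLp (T := 1) ∞ n] with x h1 h2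
  rw [mulZPow, h1, h2]

theorem mulZPow_fourierLp (m n : ℤ) : mulZPow m (𝐞 n) = 𝐞 (m + n) := by
  apply Lp.ext
  filter_upwards [coeFn_mulZPow m (𝐞 n), coeFn_fourierLp (T := 1) 2 n,
    coeFn_fourierLp (T := 1) 2 (m + n)] with x h1 h2 h3
  rw [h1, h2, h3, fourier_add]

theorem mulZPow_mulZPow (m n : ℤ) (f : L2) : mulZPow m (mulZPow n f) = mulZPow (m + n) f := by
  apply Lp.ext
  filter_upwards [coeFn_mulZPow m (mulZPow n f), coeFn_mulZPow n f,
    coeFn_mulZPow (m + n) f] with x h1 h2 h3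
  rw [h1, h2, h3, fourier_add, mul_assoc]

theorem mulZPow_zero (f : L2) : mulZPow 0 f = f := by
  apply Lp.ext
  filter_upwards [coeFn_mulZPow 0 f] with x h1
  rw [h1, fourier_zero, one_mul]

theorem mulZPow_mulOp (n : ℤ) (φ : LInf) (f : L2) :
    mulZPow n (mulOp φ f) = mulOp φ (mulZPow n f) :=
  mulOp_comm _ _ _

theorem star_fourierLp (n : ℤ) :
    star (fourierLp (T := 1) ∞ n) = fourierLp (T := 1) ∞ (-n) := by
  apply Lp.ext
  filter_upwards [Lp.coeFn_star (fourierLp (T := 1) ∞ n), coeFn_fourierLp (T := 1) ∞ n,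
    coeFn_fourierLp (T := 1) ∞ (-n)] with x h1 h2 h3
  rw [h1, Pi.star_apply, h2, h3, fourier_neg]
  rfl

theorem inner_mulZPow_right (n : ℤ) (f g : L2) :
    inner ℂ f (mulZPow n g) = inner ℂ (mulZPow (-n) f) g := by
  rw [mulZPow, inner_mulOp_right, star_fourierLp, mulZPow]

theorem fourierLp_mem_H2 {n : ℤ} (hn : 0 ≤ n) : 𝐞 n ∈ H2 :=
  mem_H2_iff.2 fun _ hm => orthonormal_fourier.2 (hm.trans_le hn).ne

theorem mulZPow_mem_H2 {n : ℤ} (hn : 0 ≤ n) {f : L2} (hf : f ∈ H2) : mulZPow n f ∈ H2 := by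
  rw [mem_H2_iff] at hf ⊢
  intro m hm
  rw [inner_mulZPow_right, mulZPow_fourierLp]
  exact hf _ (by omega)

/-- The monomials `zⁿ`, `n ≥ 0`, span a dense subspace of `H²`. -/
theorem H2_le_of_fourierLp_mem {V : Submodule ℂ L2} (hV : IsClosed (V : Set L2))
    (h : ∀ n : ℤ, 0 ≤ n → 𝐞 n ∈ V) : H2 ≤ V := by
  intro f hf
  refine hV.mem_of_tendsto (hasSum_fourier_series_L2 f) (Filter.Eventually.of_forall fun s => ?_)
  refine V.sum_mem fun n _ => ?_
  rcases lt_or_ge n 0 with hn | hn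
  · rw [hf n hn, zero_smul]
    exact V.zero_mem
  · exact V.smul_mem _ (h n hn)

/-- The inclusion `L^∞ → L²`, written as `φ ↦ φ · 1`. -/
def toL2 : LInf →L[ℂ] L2 :=
  ((ContinuousLinearMap.mul ℂ ℂ).holderL haarAddCircle ∞ 2 2).flip (𝐞 0)

theorem toL2_eq_mulOp (φ : LInf) : toL2 φ = mulOp φ (𝐞 0) := rfl

theorem coeFn_toL2 (φ : LInf) : toL2 φ =ᵐ[𝓂] φ := by
  filter_upwards [coeFn_mulOp φ (𝐞 0), coeFn_fourierLp (T := 1) 2 0] with x h1 h2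
  rw [toL2_eq_mulOp, h1, h2, fourier_zero, mul_one]

theorem mem_HInf_iff {φ : LInf} : φ ∈ HInf ↔ toL2 φ ∈ H2 := by
  have h (n : ℤ) : fourierCoeff (toL2 φ) n = fourierCoeff φ n :=
    congrFun (fourierCoeff_congr_ae (coeFn_toL2 φ)) n
  change (∀ n : ℤ, n < 0 → _) ↔ ∀ n : ℤ, n < 0 → _
  simp only [h]

theorem mulOp_fourierLp (φ : LInf) (n : ℤ) : mulOp φ (𝐞 n) = mulZPow n (toL2 φ) := by
  rw [toL2_eq_mulOp, mulZPow_mulOp, mulZPow_fourierLp, add_zero]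

theorem mulOp_mem_H2 {φ : LInf} (hφ : φ ∈ HInf) {f : L2} (hf : f ∈ H2) : mulOp φ f ∈ H2 := by
  have hc : IsClosed ((H2.comap (mulOp φ).toLinearMap : Submodule ℂ L2) : Set L2) :=
    isClosed_H2.preimage (mulOp φ).continuous
  refine H2_le_of_fourierLp_mem hc (fun n hn => ?_) hf
  change mulOp φ (𝐞 n) ∈ H2
  rw [mulOp_fourierLp]
  exact mulZPow_mem_H2 hn (mem_HInf_iff.1 hφ)

/-- An essentially bounded function in `L²` comes from `L^∞`. -/
theorem exists_toL2_eq {f : L2} {C : ℝ} (h : ∀ᵐ x ∂𝓂, ‖f x‖ ≤ C) : ∃ φ : LInf, toL2 φ = f := by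
  refine ⟨(memLp_top_of_bound (Lp.aestronglyMeasurable f) C h).toLp, Lp.ext ?_⟩
  exact (coeFn_toL2 _).trans (MemLp.coeFn_toLp _)

theorem exists_norm_le (φ : LInf) : ∃ C : ℝ, ∀ᵐ x ∂𝓂, ‖φ x‖ ≤ C := by
  have h := Lp.eLpNorm_lt_top φ
  rw [eLpNorm_exponent_top] at h
  refine ⟨(eLpNormEssSup φ 𝓂).toReal, ?_⟩
  filter_upwards [ae_le_eLpNormEssSup (f := φ) (μ := 𝓂)] with x hx
  rw [← toReal_enorm]
  exact ENNReal.toReal_mono h.ne hx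

theorem norm_sq_eq_integral (f : L2) : ‖f‖ ^ 2 = ∫ x, ‖f x‖ ^ 2 ∂𝓂 := by
  have h := congr_arg RCLike.re (inner_eq_integral f f)
  rw [inner_self_eq_norm_sq, ← integral_re] at h
  · rw [h]
    congr 1 with x
    rw [RCLike.mul_conj]
    norm_cast
  · exact L2.integrable_inner (𝕜 := ℂ) f f

/-- Pointwise complex conjugation on `L²` reflects Fourier coefficients. -/
theorem inner_fourierLp_star (n : ℤ) (f : L2) :
    inner ℂ (𝐞 n) (star f) = conj (inner ℂ (𝐞 (-n)) f) := by
  rw [inner_eq_integral, inner_eq_integral, ← integral_conj]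
  apply integral_congr_ae
  filter_upwards [Lp.coeFn_star f, coeFn_fourierLp (T := 1) 2 n,
    coeFn_fourierLp (T := 1) 2 (-n)] with x h1 h2 h3
  rw [h1, h2, h3, fourier_neg]
  simp

/-! ### Beurling subspaces and model spaces -/

theorem mem_beurling {θ : InnerFunction} {f : L2} :
    f ∈ beurling θ ↔ mulOp (star (θ : LInf)) f ∈ H2 := by
  refine ⟨?_, fun h => ⟨_, h, mulOp_mulOp_star θ f⟩⟩
  rintro ⟨g, hg, rfl⟩
  change mulOp (star (θ : LInf)) (mulOp θ g) ∈ H2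
  rwa [mulOp_star_mulOp]

theorem isClosed_beurling (θ : InnerFunction) : IsClosed ((beurling θ : Submodule ℂ L2) : Set L2) :=
  (completeSpace_coe_iff_isComplete.1
    (inferInstanceAs (CompleteSpace (beurling θ)))).isClosed

theorem beurling_le_H2 (θ : InnerFunction) : beurling θ ≤ H2 := by
  rintro _ ⟨f, hf, rfl⟩
  exact mulOp_mem_H2 θ.mem_HInf hf

theorem mulZPow_mem_beurling {θ : InnerFunction} {n : ℤ} (hn : 0 ≤ n) {f : L2}
    (hf : f ∈ beurling θ) : mulZPow n f ∈ beurling θ := by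
  rw [mem_beurling] at hf ⊢
  rw [← mulZPow_mulOp]
  exact mulZPow_mem_H2 hn hf

theorem mulOp_fourierLp_orthogonal_beurling {θ : InnerFunction} {n : ℤ} (hn : n < 0) {f : L2}
    (hf : f ∈ beurling θ) : inner ℂ (mulOp θ (𝐞 n)) f = 0 := by
  obtain ⟨g, hg, rfl⟩ := hf
  exact (inner_mulOp_mulOp θ _ g).trans (mem_H2_iff.1 hg n hn)

theorem orthogonalProjectionOnto_modelSpace_eq {θ : InnerFunction} {f : L2} {k : modelSpace θ}
    (h : f - k ∈ beurling θ) : (modelSpace θ).orthogonalProjectionOnto f = k := by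
  have h0 : (modelSpace θ).orthogonalProjectionOnto (f - k) = 0 := by
    rw [Submodule.orthogonalProjectionOnto_eq_zero_iff, Submodule.mem_orthogonal]
    exact fun u hu => Submodule.inner_left_of_mem_orthogonal h hu.2
  rw [map_sub, Submodule.orthogonalProjectionOnto_mem_subspace_eq_self, sub_eq_zero] at h0
  exact h0

/-- The decomposition `H² = K_θ ⊕ θ H²`. -/
theorem sub_orthogonalProjectionOnto_mem_beurling {θ : InnerFunction} {f : L2} (hf : f ∈ H2) :
    f - (modelSpace θ).orthogonalProjectionOnto f ∈ beurling θ := by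
  set b := (beurling θ).orthogonalProjectionOnto f
  have hk : f - b ∈ modelSpace θ :=
    ⟨H2.sub_mem hf (beurling_le_H2 θ b.2), Submodule.sub_starProjection_mem_orthogonal f⟩
  rw [orthogonalProjectionOnto_modelSpace_eq (k := ⟨f - b, hk⟩)]
  · simp
  · simp

/-! ### Szegő factorization -/

/-- An integrable function with vanishing Fourier coefficients annihilates all continuous
functions. -/
theorem integral_mul_eq_zero_of_fourier {G : UnitAddCircle → ℂ} (hG : Integrable G 𝓂)
    (h : ∀ n : ℤ, ∫ x, fourier n x * G x ∂𝓂 = 0) (u : C(UnitAddCircle, ℂ)) :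
    ∫ x, u x * G x ∂𝓂 = 0 := by
  let Φ : C(UnitAddCircle, ℂ) →L[ℂ] ℂ :=
    ((ContinuousLinearMap.mul ℂ ℂ).lpPairing 𝓂 ∞ 1).flip ((memLp_one_iff_integrable.2 hG).toLp G)
      ∘L ContinuousMap.toLp ∞ 𝓂 ℂ
  have hΦ (u : C(UnitAddCircle, ℂ)) : Φ u = ∫ x, u x * G x ∂𝓂 := by
    refine (ContinuousLinearMap.lpPairing_eq_integral _ _ _).trans (integral_congr_ae ?_)
    filter_upwards [(memLp_one_iff_integrable.2 hG).coeFn_toLp,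
      ContinuousMap.coeFn_toLp (p := ∞) (𝕜 := ℂ) 𝓂 u] with x h1 h2
    exact congrArg₂ (· * ·) h2 h1
  have hle : (⊤ : Submodule ℂ C(UnitAddCircle, ℂ)) ≤ Φ.ker := by
    rw [← span_fourier_closure_eq_top]
    refine Submodule.topologicalClosure_minimal _ (Submodule.span_le.2 ?_) Φ.isClosed_ker
    rintro _ ⟨n, rfl⟩
    exact (hΦ _).trans (h n)
  rw [← hΦ]
  exact hle (Submodule.mem_top (x := u))

/-- A nonnegative integrable function whose Fourier coefficients of nonzero index vanish is
constant. -/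
theorem ae_eq_integral_of_fourier {F : UnitAddCircle → ℝ} (hF : Integrable F 𝓂)
    (h0 : ∀ x, 0 ≤ F x) (h : ∀ n : ℤ, n ≠ 0 → ∫ x, fourier n x * (F x : ℂ) ∂𝓂 = 0) :
    F =ᵐ[𝓂] fun _ => ∫ x, F x ∂𝓂 := by
  set c := ∫ x, F x ∂𝓂
  have hc : 0 ≤ c := integral_nonneg h0
  have hG : Integrable (fun x => (F x : ℂ) - c) 𝓂 := hF.ofReal.sub (integrable_const _)
  have hu (n : ℤ) : Integrable (fun x => fourier n x * (F x : ℂ)) 𝓂 :=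
    hF.ofReal.fourier_smul n
  have key := integral_mul_eq_zero_of_fourier hG fun n => by
    have h1 : ∫ x, fourier n x * (c : ℂ) ∂𝓂 = if n = 0 then (c : ℂ) else 0 := by
      rw [integral_mul_const]
      have := fourierCoeff_fourier (T := 1) n
      have := congrFun this 0
      rw [fourierCoeff] at this
      simp only [neg_zero, fourier_zero, one_smul] at this
      rw [this, Pi.single_apply]
      simp [eq_comm]
    simp only [mul_sub]
    have h2 : Integrable (fun x => fourier n x * (c : ℂ)) 𝓂 :=
      (integrable_const (c : ℂ)).fourier_smul n
    rw [integral_sub (hu n) h2, h1]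
    split_ifs with hn
    · subst hn
      simp only [fourier_zero, one_mul]
      rw [integral_complex_ofReal, sub_self]
    · rw [h n hn, sub_zero]
  have hfin : IsFiniteMeasure ((𝓂).withDensity fun x => ENNReal.ofReal (F x)) :=
    isFiniteMeasure_withDensity_ofReal hF.2
  have hfin' : IsFiniteMeasure ((𝓂).withDensity fun _ => ENNReal.ofReal c) :=
    isFiniteMeasure_withDensity_ofReal (integrable_const c).2
  have hmeas : (𝓂).withDensity (fun x => ENNReal.ofReal (F x)) =
      (𝓂).withDensity fun _ => ENNReal.ofReal c := by
    apply ext_of_forall_integral_eq_of_IsFiniteMeasure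
    intro u
    rw [integral_withDensity_eq_integral_toReal_smul₀ hF.1.aemeasurable.ennreal_ofReal (by simp),
      integral_withDensity_eq_integral_toReal_smul₀ aemeasurable_const (by simp)]
    simp only [ENNReal.toReal_ofReal (h0 _), ENNReal.toReal_ofReal hc, smul_eq_mul]
    have hk := key ⟨fun x => (u x : ℂ), by fun_prop⟩
    have h2 : ∫ x, u x * (F x - c) ∂𝓂 = 0 := by
      rw [← Complex.ofReal_inj, ← integral_complex_ofReal, ← hk.trans Complex.ofReal_zero.symm]
      simp
    have hi (v : UnitAddCircle → ℝ) (hv : Integrable v 𝓂) :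
        Integrable (fun x => v x * u x) 𝓂 :=
      hv.mul_bdd u.continuous.aestronglyMeasurable
        (Filter.Eventually.of_forall fun x => u.norm_coe_le_norm x)
    rw [← sub_eq_zero, ← integral_sub (hi F hF) (hi _ (integrable_const c)), ← h2]
    congr 1 with x
    ring
  have hae := (withDensity_eq_iff_of_sigmaFinite hF.1.aemeasurable.ennreal_ofReal
    aemeasurable_const).1 hmeas
  filter_upwards [hae] with x hx
  exact (ENNReal.ofReal_eq_ofReal_iff (h0 x) hc).1 hx

/-- **Szegő factorization** of a weight `q` bounded above and away from `0`: there are `w` and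
`v` in `H^∞` with `w v = 1` and `|w|² = q`. -/
theorem exists_szego_factorization {q : UnitAddCircle → ℝ} (hq : AEStronglyMeasurable q 𝓂)
    {a b : ℝ} (ha : 0 < a) (hqa : ∀ᵐ x ∂𝓂, a ≤ q x) (hqb : ∀ᵐ x ∂𝓂, q x ≤ b) :
    ∃ w ∈ HInf, ∃ v ∈ HInf, (∀ᵐ x ∂𝓂, w x * v x = 1) ∧ ∀ᵐ x ∂𝓂, ‖w x‖ ^ 2 = q x := by
  have hsm : MemLp (fun x => ((√(q x) : ℝ) : ℂ)) ∞ 𝓂 := by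
    refine memLp_top_of_bound ?_ (√b) ?_
    · exact Complex.continuous_ofReal.comp_aestronglyMeasurable
        (Real.continuous_sqrt.comp_aestronglyMeasurable hq)
    · filter_upwards [hqb] with x hx
      rw [Complex.norm_real, Real.norm_of_nonneg (Real.sqrt_nonneg _)]
      exact Real.sqrt_le_sqrt hx
  have hrm : MemLp (fun x => (((√(q x))⁻¹ : ℝ) : ℂ)) ∞ 𝓂 := by
    refine memLp_top_of_bound ?_ ((√a)⁻¹) ?_
    · exact Complex.continuous_ofReal.comp_aestronglyMeasurable
        (Real.continuous_sqrt.comp_aestronglyMeasurable hq).aemeasurable.inv.aestronglyMeasurable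
    · filter_upwards [hqa] with x hx
      rw [Complex.norm_real, Real.norm_of_nonneg (by positivity)]
      gcongr
  set s : LInf := hsm.toLp
  set r : LInf := hrm.toLp
  have hs : ∀ᵐ x ∂𝓂, s x = (√(q x) : ℝ) := hsm.coeFn_toLp
  have hr : ∀ᵐ x ∂𝓂, r x = ((√(q x))⁻¹ : ℝ) := hrm.coeFn_toLp
  have hrs (f : L2) : mulOp r (mulOp s f) = f := by
    apply mulOp_eq_of_ae
    filter_upwards [hs, hr, coeFn_mulOp s f, hqa] with x h1 h2 h3 h4
    have : 0 < √(q x) := Real.sqrt_pos.2 (ha.trans_le h4)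
    rw [h3, h1, h2, ← mul_assoc, ← Complex.ofReal_mul, inv_mul_cancel₀ this.ne']
    simp
  have hstar : star s = s := by
    apply Lp.ext
    filter_upwards [hs, Lp.coeFn_star s] with x h1 h2
    rw [h2, Pi.star_apply, h1, RCLike.star_def, Complex.conj_ofReal]
  -- `V = s · z H²`; the function `g` below is `s` times the minimizer of `∫ |f|² q` over
  -- `f ∈ 1 + z H²`.
  let V : Submodule ℂ L2 := H2.comap (mulZPow (-1) ∘L mulOp r).toLinearMap
  have hVmem (f : L2) : f ∈ V ↔ mulZPow (-1) (mulOp r f) ∈ H2 := Iff.rfl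
  have hVc : IsClosed (V : Set L2) := isClosed_H2.preimage (mulZPow (-1) ∘L mulOp r).continuous
  have : CompleteSpace V := hVc.completeSpace_coe
  let g : L2 := mulOp s (𝐞 0) - V.orthogonalProjectionOnto (mulOp s (𝐞 0))
  have hg : g ∈ Vᗮ := Submodule.sub_starProjection_mem_orthogonal _
  have hrV {f : L2} (hf : f ∈ V) : mulOp r f ∈ H2 := by
    have := mulZPow_mem_H2 zero_le_one ((hVmem f).1 hf)
    rwa [mulZPow_mulZPow, add_neg_cancel, mulZPow_zero] at this
  have hrg : mulOp r g ∈ H2 := by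
    rw [map_sub, hrs]
    exact H2.sub_mem (fourierLp_mem_H2 le_rfl) (hrV (Submodule.coe_mem _))
  have hg0 : g ≠ 0 := by
    intro h
    have h1 : mulOp s (𝐞 0) ∈ V := by
      rw [sub_eq_zero.1 h]
      exact Submodule.coe_mem _
    rw [hVmem, hrs, mulZPow_fourierLp, mem_H2_iff] at h1
    have h2 := h1 (-1) (by norm_num)
    rw [add_zero, inner_self_eq_zero] at h2
    exact orthonormal_fourier.ne_zero _ h2
  have horth1 (n : ℤ) (hn : 0 < n) : inner ℂ (mulZPow n g) g = 0 := by
    refine hg _ ?_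
    rw [hVmem, ← mulZPow_mulOp, mulZPow_mulZPow]
    exact mulZPow_mem_H2 (by omega) hrg
  have horth2 (n : ℤ) (hn : 0 < n) : inner ℂ (𝐞 n) (mulOp s g) = 0 := by
    rw [inner_mulOp_right, hstar]
    refine hg _ ?_
    rw [hVmem, hrs, mulZPow_fourierLp]
    exact fourierLp_mem_H2 (by omega)
  -- `|g|²` is constant because `g` is orthogonal to `zⁿ g` for every `n ≠ 0`.
  have hconst : ∀ᵐ x ∂𝓂, ‖g x‖ ^ 2 = ‖g‖ ^ 2 := by
    rw [norm_sq_eq_integral]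
    have hint : Integrable (fun x => ‖g x‖ ^ 2) 𝓂 := (Lp.memLp g).norm.integrable_sq
    refine ae_eq_integral_of_fourier hint (fun x => by positivity) fun n hn => ?_
    have h1 : inner ℂ g (mulZPow n g) = 0 := by
      rcases lt_or_gt_of_ne hn with hn | hn
      · rw [inner_mulZPow_right, horth1 _ (by omega)]
      · rw [← inner_conj_symm, horth1 _ hn, map_zero]
    rw [← h1, inner_eq_integral]
    apply integral_congr_ae
    filter_upwards [coeFn_mulZPow n g] with x hx
    rw [hx, mul_assoc, RCLike.mul_conj]
    norm_cast
  have hc : 0 < ‖g‖ := norm_pos_iff.2 hg0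
  let d : ℂ := ((‖g‖⁻¹ : ℝ) : ℂ)
  have hW : star (mulOp s g) ∈ H2 := mem_H2_iff.2 fun n hn => by
    rw [inner_fourierLp_star, horth2 _ (by omega), map_zero]
  have hsg : ∀ᵐ x ∂𝓂, (d • star (mulOp s g)) x = d * ((√(q x) : ℝ) * conj (g x)) := by
    filter_upwards [Lp.coeFn_smul d (star (mulOp s g)), Lp.coeFn_star (mulOp s g),
      coeFn_mulOp s g, hs] with x h1 h2 h3 h4
    rw [h1, Pi.smul_apply, h2, Pi.star_apply, h3, h4]
    simp
  have hrg' : ∀ᵐ x ∂𝓂, (d • mulOp r g) x = d * (((√(q x))⁻¹ : ℝ) * g x) := by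
    filter_upwards [Lp.coeFn_smul d (mulOp r g), coeFn_mulOp r g, hr] with x h1 h3 h4
    rw [h1, Pi.smul_apply, h3, h4]
    simp
  have hnorm : ∀ᵐ x ∂𝓂, ‖g x‖ = ‖g‖ := by
    filter_upwards [hconst] with x hx
    exact (sq_eq_sq₀ (norm_nonneg _) (norm_nonneg _)).1 hx
  have hnd : ‖d‖ = ‖g‖⁻¹ := by
    rw [Complex.norm_real, Real.norm_of_nonneg (by positivity)]
  have hwn : ∀ᵐ x ∂𝓂, ‖(d • star (mulOp s g)) x‖ = √(q x) := by
    filter_upwards [hsg, hnorm] with x h1 h2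
    rw [h1, norm_mul, norm_mul, hnd, RCLike.norm_conj, h2, Complex.norm_real,
      Real.norm_of_nonneg (Real.sqrt_nonneg _)]
    field_simp
  have hvn : ∀ᵐ x ∂𝓂, ‖(d • mulOp r g) x‖ = (√(q x))⁻¹ := by
    filter_upwards [hrg', hnorm] with x h1 h2
    rw [h1, norm_mul, norm_mul, hnd, h2, Complex.norm_real,
      Real.norm_of_nonneg (by positivity)]
    field_simp
  obtain ⟨w, hw⟩ := exists_toL2_eq (f := d • star (mulOp s g)) (C := √b) (by
    filter_upwards [hwn, hqb] with x h1 h2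
    rw [h1]
    exact Real.sqrt_le_sqrt h2)
  obtain ⟨v, hv⟩ := exists_toL2_eq (f := d • mulOp r g) (C := (√a)⁻¹) (by
    filter_upwards [hvn, hqa] with x h1 h2
    rw [h1]
    gcongr)
  have hw' := coeFn_toL2 w
  have hv' := coeFn_toL2 v
  rw [hw] at hw'
  rw [hv] at hv'
  refine ⟨w, mem_HInf_iff.2 (hw ▸ H2.smul_mem _ hW), v, mem_HInf_iff.2 (hv ▸ H2.smul_mem _ hrg),
    ?_, ?_⟩
  · filter_upwards [hw', hv', hsg, hrg', hnorm, hqa] with x h1 h2 h3 h4 h5 h6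
    have hpos : 0 < √(q x) := Real.sqrt_pos.2 (ha.trans_le h6)
    rw [← h1, ← h2, h3, h4]
    have h7 : conj (g x) * g x = ((‖g‖ ^ 2 : ℝ) : ℂ) := by
      rw [RCLike.conj_mul, h5]
      norm_cast
    calc _ = d ^ 2 * ((√(q x) * (√(q x))⁻¹ : ℝ) : ℂ) * (conj (g x) * g x) := by
          push_cast
          ring
      _ = 1 := by
          rw [h7, mul_inv_cancel₀ hpos.ne', Complex.ofReal_one, mul_one, ← Complex.ofReal_pow,
            ← Complex.ofReal_mul, ← mul_pow, inv_mul_cancel₀ hc.ne', one_pow, Complex.ofReal_one]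
  · filter_upwards [hw', hwn, hqa] with x h1 h2 h3
    rw [← h1, h2, Real.sq_sqrt (ha.le.trans h3)]

/-! ### The functional attached to an intertwining operator -/

theorem norm_eq_of_ae {f g : L2} (h : ∀ᵐ x ∂𝓂, ‖f x‖ = ‖g x‖) : ‖f‖ = ‖g‖ := by
  rw [Lp.norm_def, Lp.norm_def, eLpNorm_congr_norm_ae h]

theorem norm_mulZPow (n : ℤ) (f : L2) : ‖mulZPow n f‖ = ‖f‖ := by
  apply norm_eq_of_ae
  filter_upwards [coeFn_mulZPow n f] with x hx
  rw [hx, norm_mul, fourier_apply, Circle.norm_coe, one_mul]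

theorem norm_star_L2 (f : L2) : ‖star f‖ = ‖f‖ := by
  apply norm_eq_of_ae
  filter_upwards [Lp.coeFn_star f] with x hx
  rw [hx, Pi.star_apply, norm_star]

section Intertwining

variable {θ : InnerFunction} {B : L2 →L[ℂ] L2}

theorem map_mulZPow_sub_mem_beurling
    (hB : ∀ f ∈ H2, B (mulZ f) - mulZ (B f) ∈ beurling θ) (n : ℕ) {f : L2} (hf : f ∈ H2) :
    B (mulZPow n f) - mulZPow n (B f) ∈ beurling θ := by
  induction n with
  | zero => simp [mulZPow_zero]
  | succ n ih =>
    have h1 := hB _ (mulZPow_mem_H2 (Int.natCast_nonneg n) hf)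
    have h2 := mulZPow_mem_beurling zero_le_one ih
    rw [mulZ_eq, mulZPow_mulZPow] at h1
    rw [map_sub, mulZPow_mulZPow] at h2
    have h3 := (beurling θ).add_mem h1 h2
    rw [sub_add_sub_cancel, add_comm (1 : ℤ)] at h3
    exact_mod_cast h3

theorem inner_map_mulZPow
    (hB : ∀ f ∈ H2, B (mulZ f) - mulZ (B f) ∈ beurling θ) {n : ℤ} (hn : 0 ≤ n) {f : L2}
    (hf : f ∈ H2) :
    inner ℂ (mulOp θ (𝐞 (-1))) (B (mulZPow n f)) =
      inner ℂ (mulOp θ (𝐞 (-1))) (mulZPow n (B f)) := by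
  lift n to ℕ using hn
  rw [← sub_eq_zero, ← inner_sub_right]
  exact mulOp_fourierLp_orthogonal_beurling (by norm_num) (map_mulZPow_sub_mem_beurling hB n hf)

/-- The bilinear form `(φ, g) ↦ ∫ z θ̄ B(φ g)` is also `∫ z θ̄ B(φ) g`. -/
theorem inner_map_mulOp
    (hB : ∀ f ∈ H2, B (mulZ f) - mulZ (B f) ∈ beurling θ) {φ : LInf} (hφ : φ ∈ HInf) {g : L2}
    (hg : g ∈ H2) :
    inner ℂ (mulOp θ (𝐞 (-1))) (B (mulOp φ g)) =
      inner ℂ (mulOp θ (mulZPow (-1) (star (B (toL2 φ))))) g := by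
  let Φ : L2 →L[ℂ] ℂ := innerSL ℂ (mulOp θ (𝐞 (-1))) ∘L B ∘L mulOp φ -
    innerSL ℂ (mulOp θ (mulZPow (-1) (star (B (toL2 φ)))))
  have hΦ : H2 ≤ Φ.ker := by
    refine H2_le_of_fourierLp_mem Φ.isClosed_ker fun n hn => ?_
    refine LinearMap.mem_ker.2 (sub_eq_zero.2 ?_)
    change inner ℂ (mulOp θ (𝐞 (-1))) (B (mulOp φ (𝐞 n))) = inner ℂ _ (𝐞 n)
    rw [mulOp_fourierLp φ, inner_map_mulZPow hB hn (mem_HInf_iff.1 hφ), inner_eq_integral,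
      inner_eq_integral]
    apply integral_congr_ae
    set k := B (toL2 φ)
    filter_upwards [coeFn_mulOp θ (𝐞 (-1)), coeFn_fourierLp (T := 1) 2 (-1), coeFn_mulZPow n k,
      coeFn_fourierLp (T := 1) 2 n, coeFn_mulOp θ (mulZPow (-1) (star k)),
      coeFn_mulZPow (-1) (star k), Lp.coeFn_star k] with x h1 h2 h3 h4 h5 h6 h7
    rw [h1, h2, h3, h4, h5, h6, h7]
    simp
    ring
  exact sub_eq_zero.1 (LinearMap.mem_ker.1 (hΦ hg))

theorem norm_inner_map_mulOp_le
    (hB : ∀ f ∈ H2, B (mulZ f) - mulZ (B f) ∈ beurling θ) {φ : LInf} (hφ : φ ∈ HInf) {g : L2}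
    (hg : g ∈ H2) :
    ‖inner ℂ (mulOp θ (𝐞 (-1))) (B (mulOp φ g))‖ ≤ ‖B‖ * ‖toL2 φ‖ * ‖g‖ := by
  rw [inner_map_mulOp hB hφ hg]
  refine (norm_inner_le_norm _ _).trans ?_
  rw [norm_mulOp, norm_mulZPow, norm_star_L2]
  gcongr
  exact B.le_opNorm _

theorem integrable_norm (f : L2) : Integrable (fun x => ‖f x‖) 𝓂 :=
  ((Lp.memLp f).integrable one_le_two).norm

/-- The functional `h ↦ ∫ z θ̄ B h` is bounded by the `L¹` norm on `H^∞`: write `h` as the product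
of two functions in `H²` whose squared norms are at most `‖h‖₁ + ε`. -/
theorem norm_inner_map_le
    (hB : ∀ f ∈ H2, B (mulZ f) - mulZ (B f) ∈ beurling θ) {h : LInf} (hh : h ∈ HInf) :
    ‖inner ℂ (mulOp θ (𝐞 (-1))) (B (toL2 h))‖ ≤ ‖B‖ * ∫ x, ‖toL2 h x‖ ∂𝓂 := by
  set I := ∫ x, ‖toL2 h x‖ ∂𝓂
  have hlim : Filter.Tendsto (fun ε : ℝ => ‖B‖ * (I + ε)) (nhdsWithin 0 (Set.Ioi 0))
      (nhds (‖B‖ * (I + 0))) :=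
    tendsto_nhdsWithin_of_tendsto_nhds
      (Continuous.tendsto (f := fun ε : ℝ => ‖B‖ * (I + ε)) (by fun_prop) 0)
  rw [add_zero] at hlim
  refine ge_of_tendsto hlim (Filter.eventually_of_mem self_mem_nhdsWithin fun ε (hε : 0 < ε) => ?_)
  obtain ⟨C, hC⟩ := exists_norm_le h
  have hi := integrable_norm (toL2 h)
  obtain ⟨w, hw, v, hv, hwv, hwq⟩ := exists_szego_factorization
    (q := fun x => ‖toL2 h x‖ + ε) (a := ε) (b := C + ε)
    ((hi.add (integrable_const ε)).aestronglyMeasurable) hε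
    (Filter.Eventually.of_forall fun x => by simp)
    (by
      filter_upwards [hC, coeFn_toL2 h] with x h1 h2
      rw [h2]
      gcongr)
  have hprod : mulOp w (mulOp v (toL2 h)) = toL2 h := by
    apply mulOp_eq_of_ae
    filter_upwards [coeFn_mulOp v (toL2 h), hwv] with x h1 h2
    rw [h1, ← mul_assoc, h2, one_mul]
  have hI : ∫ x, (‖toL2 h x‖ + ε) ∂𝓂 = I + ε := by
    rw [integral_add hi (integrable_const ε)]
    simp [I]
  have h1 : ‖toL2 w‖ ^ 2 = I + ε := by
    rw [norm_sq_eq_integral, ← hI]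
    apply integral_congr_ae
    filter_upwards [hwq, coeFn_toL2 w] with x h1 h2
    rw [h2, h1]
  have h2 : ‖mulOp v (toL2 h)‖ ^ 2 ≤ I + ε := by
    rw [norm_sq_eq_integral, ← hI]
    refine integral_mono_ae (Lp.memLp _).norm.integrable_sq (hi.add (integrable_const ε)) ?_
    filter_upwards [coeFn_mulOp v (toL2 h), hwv, hwq] with x h1 h2 h3
    set t := ‖toL2 h x‖
    have ht : 0 ≤ t := norm_nonneg _
    have h4 : (t + ε) * ‖v x‖ ^ 2 = 1 := by
      rw [← h3, ← mul_pow, ← norm_mul, h2, norm_one, one_pow]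
    change ‖mulOp v (toL2 h) x‖ ^ 2 ≤ t + ε
    rw [h1, norm_mul]
    calc (‖v x‖ * t) ^ 2 ≤ (‖v x‖ * (t + ε)) ^ 2 := by gcongr; linarith
      _ = (t + ε) * ((t + ε) * ‖v x‖ ^ 2) := by ring
      _ = t + ε := by rw [h4, mul_one]
  have h3 := norm_inner_map_mulOp_le hB hw (mulOp_mem_H2 hv (mem_HInf_iff.1 hh))
  rw [hprod] at h3
  refine h3.trans ?_
  rw [mul_assoc]
  gcongr
  nlinarith [sq_nonneg (‖toL2 w‖ - ‖mulOp v (toL2 h)‖)]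

end Intertwining

/-! ### Representation of functionals dominated by the `L¹` norm -/

theorem integral_norm_le (f : L2) : ∫ x, ‖f x‖ ∂𝓂 ≤ ‖f‖ := by
  set m := ∫ x, ‖f x‖ ∂𝓂
  have hi := (integrable_norm f).const_mul (2 * m)
  have h : ∫ x, (2 * m * ‖f x‖ - m ^ 2) ∂𝓂 ≤ ∫ x, ‖f x‖ ^ 2 ∂𝓂 :=
    integral_mono (hi.sub (integrable_const _)) (Lp.memLp f).norm.integrable_sq
      fun x => by change 2 * m * ‖f x‖ - m ^ 2 ≤ ‖f x‖ ^ 2; nlinarith [sq_nonneg (‖f x‖ - m)]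
  rw [← norm_sq_eq_integral, integral_sub hi (integrable_const _), integral_const_mul] at h
  refine le_of_sq_le_sq ?_ (norm_nonneg f)
  simp only [integral_const, probReal_univ, one_smul] at h
  linarith

/-- The seminorm `f ↦ C ‖f‖₁` on `L²`. -/
def l1Seminorm (C : ℝ) (hC : 0 ≤ C) : Seminorm ℂ L2 :=
  Seminorm.of (fun f => C * ∫ x, ‖f x‖ ∂𝓂)
    (fun f g => by
      rw [← mul_add, ← integral_add (integrable_norm f) (integrable_norm g)]
      refine mul_le_mul_of_nonneg_left (integral_mono_ae (integrable_norm _)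
        ((integrable_norm f).add (integrable_norm g)) ?_) hC
      filter_upwards [Lp.coeFn_add f g] with x hx
      rw [hx]
      exact norm_add_le _ _)
    (fun c f => by
      rw [mul_left_comm, ← integral_const_mul ‖c‖]
      congr 1
      apply integral_congr_ae
      filter_upwards [Lp.coeFn_smul c f] with x hx
      rw [hx, Pi.smul_apply, norm_smul])

/-- If `f ↦ ⟪u, f⟫` is bounded by `C ‖f‖₁`, then `|u| ≤ C` almost everywhere. -/
theorem ae_norm_le_of_inner_le {u : L2} {C : ℝ} (hC : 0 ≤ C)
    (h : ∀ f : L2, ‖inner ℂ u f‖ ≤ C * ∫ x, ‖f x‖ ∂𝓂) : ∀ᵐ x ∂𝓂, ‖u x‖ ≤ C := by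
  have hm : MeasurableSet {x | C < ‖u x‖} :=
    measurableSet_lt measurable_const (Lp.stronglyMeasurable u).norm.measurable
  set E := {x | C < ‖u x‖}
  have hmem : MemLp (E.indicator u) 2 𝓂 := (Lp.memLp u).indicator hm
  have h1 := h (hmem.toLp _)
  have h2 : inner ℂ u (hmem.toLp _) = ((∫ x, E.indicator (fun x => ‖u x‖ ^ 2) x ∂𝓂 : ℝ) : ℂ) := by
    rw [inner_eq_integral, ← integral_complex_ofReal]
    apply integral_congr_ae
    filter_upwards [hmem.coeFn_toLp] with x hx
    rw [hx]
    by_cases hxE : x ∈ E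
    · rw [Set.indicator_of_mem hxE, Set.indicator_of_mem hxE, RCLike.mul_conj]
      norm_cast
    · simp [Set.indicator_of_notMem hxE]
  have h3 : ∫ x, ‖hmem.toLp _ x‖ ∂𝓂 = ∫ x, E.indicator (fun x => ‖u x‖) x ∂𝓂 := by
    apply integral_congr_ae
    filter_upwards [hmem.coeFn_toLp] with x hx
    rw [hx, norm_indicator_eq_indicator_norm]
  have i2 : Integrable (E.indicator (fun x => ‖u x‖ ^ 2)) 𝓂 :=
    (Lp.memLp u).norm.integrable_sq.indicator hm
  have i1 : Integrable (E.indicator (fun x => ‖u x‖)) 𝓂 := (integrable_norm u).indicator hm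
  have hpos (x) : 0 ≤ E.indicator (fun x => ‖u x‖ ^ 2) x - C * E.indicator (fun x => ‖u x‖) x := by
    by_cases hxE : x ∈ E
    · rw [Set.indicator_of_mem hxE, Set.indicator_of_mem hxE]
      have : C < ‖u x‖ := hxE
      nlinarith [norm_nonneg (u x)]
    · simp [Set.indicator_of_notMem hxE]
  rw [h2, h3, Complex.norm_real] at h1
  have h4 : ∫ x, (E.indicator (fun x => ‖u x‖ ^ 2) x - C * E.indicator (fun x => ‖u x‖) x) ∂𝓂
      = 0 := by
    apply le_antisymm _ (integral_nonneg hpos)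
    rw [integral_sub i2 (i1.const_mul C), integral_const_mul]
    linarith [Real.le_norm_self (∫ x, E.indicator (fun x => ‖u x‖ ^ 2) x ∂𝓂)]
  rw [integral_eq_zero_iff_of_nonneg hpos (i2.sub (i1.const_mul C))] at h4
  filter_upwards [h4] with x hx
  by_contra! hlt
  have hxE : x ∈ E := hlt
  simp only [Set.indicator_of_mem hxE, Pi.zero_apply] at hx
  nlinarith [norm_nonneg (u x)]

theorem fourierLp_eq_toL2 (n : ℤ) : 𝐞 n = toL2 (fourierLp ∞ n) := by
  rw [toL2_eq_mulOp]
  exact (by rw [mulZPow_fourierLp, add_zero] : 𝐞 n = mulZPow n (𝐞 0))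

/-- Hahn–Banach and Riesz: a functional `f ↦ ⟪u, f⟫` which is bounded by the `L¹` norm on `H^∞`
agrees there with the functional of a bounded function. -/
theorem exists_inner_toL2_eq {u : L2} {C : ℝ} (hC : 0 ≤ C)
    (h : ∀ f ∈ HInf, ‖inner ℂ u (toL2 f)‖ ≤ C * ∫ x, ‖toL2 f x‖ ∂𝓂) :
    ∃ φ : LInf, ∀ n : ℤ, 0 ≤ n → inner ℂ (toL2 φ) (𝐞 n) = inner ℂ u (𝐞 n) := by
  let S : Submodule ℂ L2 := H2 ⊓ toL2.range
  let ℓ : Module.Dual ℂ S := (innerSL ℂ u).toLinearMap.comp S.subtype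
  have hℓ (x : S) : ‖ℓ x‖ ≤ l1Seminorm C hC x := by
    obtain ⟨x, hx, f, rfl⟩ := x
    exact h f (mem_HInf_iff.2 hx)
  obtain ⟨F, hFS, hF⟩ := ℓ.exists_extension_of_le_seminorm S hℓ
  let F' : StrongDual ℂ L2 := F.mkContinuous C fun f =>
    (hF f).trans (mul_le_mul_of_nonneg_left (integral_norm_le f) hC)
  set u' : L2 := (InnerProductSpace.toDual ℂ L2).symm F'
  have hu' (f : L2) : inner ℂ u' f = F f := InnerProductSpace.toDual_symm_apply
  obtain ⟨φ, hφ⟩ := exists_toL2_eq (ae_norm_le_of_inner_le (u := u') hC fun f => by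
    rw [hu']
    exact hF f)
  refine ⟨φ, fun n hn => ?_⟩
  rw [hφ, hu']
  exact hFS ⟨𝐞 n, fourierLp_mem_H2 hn, fourierLp ∞ n, (fourierLp_eq_toL2 n).symm⟩

/-! ### Lifting intertwining operators -/

/-- **Sarason's lifting theorem**: an operator on `L²` that intertwines, modulo `θ H²`, the
shift on `H²` with multiplication by `z` agrees on `H²`, modulo `θ H²`, with multiplication by a
function in `H^∞`. -/
theorem exists_mulOp_sub_mem_beurling {θ : InnerFunction} {B : L2 →L[ℂ] L2}
    (hB : ∀ f ∈ H2, B (mulZ f) - mulZ (B f) ∈ beurling θ) (hB0 : B (𝐞 0) ∈ H2) :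
    ∃ ψ ∈ HInf, ∀ f ∈ H2, mulOp ψ f - B f ∈ beurling θ := by
  obtain ⟨φ, hφ⟩ := exists_inner_toL2_eq
    (u := ContinuousLinearMap.adjoint B (mulOp θ (𝐞 (-1)))) (norm_nonneg B) (fun f hf => by
      rw [ContinuousLinearMap.adjoint_inner_left]
      exact norm_inner_map_le hB hf)
  simp only [ContinuousLinearMap.adjoint_inner_left] at hφ
  -- `ψ = θ z̄ φ̄`, so that `∫ z θ̄ ψ zⁿ = ⟪φ, zⁿ⟫`.
  let ψ : LInf := (θ : LInf) • (fourierLp (T := 1) ∞ (-1) • star φ : LInf)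
  have hψ (f : L2) : mulOp ψ f = mulOp θ (mulZPow (-1) (mulOp (star φ) f)) := by
    rw [mulOp_smul, mulOp_smul, mulZPow]
  have hmono (m : ℤ) (hm : 0 ≤ m) : mulOp ψ (𝐞 m) - B (𝐞 m) ∈ beurling θ := by
    rw [mem_beurling, mem_H2_iff]
    intro n hn
    have h1 : inner ℂ (mulOp θ (𝐞 n)) (mulOp ψ (𝐞 m)) = inner ℂ (toL2 φ) (𝐞 (m - 1 - n)) := by
      rw [hψ, inner_mulOp_mulOp, inner_mulZPow_right, mulZPow_fourierLp, inner_mulOp_right,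
        star_star, mulOp_fourierLp φ, ← neg_neg (- -1 + n), ← inner_mulZPow_right,
        mulZPow_fourierLp]
      ring_nf
    have h2 : inner ℂ (mulOp θ (𝐞 n)) (B (𝐞 m)) = inner ℂ (toL2 φ) (𝐞 (m - 1 - n)) := by
      have h3 := inner_map_mulZPow hB (n := -1 - n) (by omega) (fourierLp_mem_H2 hm)
      rw [mulZPow_fourierLp, inner_mulZPow_right, mulZPow_mulOp, mulZPow_fourierLp] at h3
      rw [show -1 - n + m = m - 1 - n by ring, show -(-1 - n) + -1 = n by ring] at h3
      rw [hφ _ (by omega), h3]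
    rw [inner_mulOp_right, star_star, inner_sub_right, h1, h2, sub_self]
  refine ⟨ψ, ?_, fun f hf => ?_⟩
  · rw [mem_HInf_iff, toL2_eq_mulOp]
    have := H2.add_mem (beurling_le_H2 θ (hmono 0 le_rfl)) hB0
    rwa [sub_add_cancel] at this
  · have hc : IsClosed (((beurling θ).comap (mulOp ψ - B).toLinearMap : Submodule ℂ L2) : Set L2) :=
      (isClosed_beurling θ).preimage (mulOp ψ - B).continuous
    exact H2_le_of_fourierLp_mem hc hmono hf

/-! ### Compressed shifts and restricted Toeplitz operators -/

theorem coe_beurlingShift {η : InnerFunction} (h : beurling η) :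
    (beurlingShift η h : L2) = mulZ h :=
  Submodule.starProjection_eq_self_iff.2 (mulZPow_mem_beurling zero_le_one h.2)

theorem mulZ_sub_compressedShift_mem_beurling {θ : InnerFunction} (k : modelSpace θ) :
    mulZ k - compressedShift θ k ∈ beurling θ :=
  sub_orthogonalProjectionOnto_mem_beurling (mulZPow_mem_H2 zero_le_one k.2.1)

theorem mulOp_conj_mul {η : InnerFunction} {ψ : LInf} (f : L2) :
    mulOp (star (η : LInf) • ψ) (mulOp η f) = mulOp ψ f := by
  rw [mulOp_smul, mulOp_comm ψ, mulOp_star_mulOp]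

theorem restrictedToeplitz_comp_beurlingShift {η θ : InnerFunction} {φ : LInf}
    (hφ : φ ∈ conjMulHInf η) :
    restrictedToeplitz η θ φ ∘L beurlingShift η = compressedShift θ ∘L restrictedToeplitz η θ φ := by
  obtain ⟨ψ, hψ, rfl⟩ := hφ
  ext1 h
  obtain ⟨f, hf, hfh⟩ := h.2
  change mulOp η f = h at hfh
  refine orthogonalProjectionOnto_modelSpace_eq ?_
  set k := restrictedToeplitz η θ (star (η : LInf) • ψ) h
  have h1 : mulOp (star (η : LInf) • ψ) h - k ∈ beurling θ := by
    refine sub_orthogonalProjectionOnto_mem_beurling ?_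
    rw [← hfh, mulOp_conj_mul]
    exact mulOp_mem_H2 hψ hf
  have h2 := (beurling θ).add_mem (mulZPow_mem_beurling zero_le_one h1)
    (mulZ_sub_compressedShift_mem_beurling k)
  rw [map_sub, ← mulZ_eq, sub_add_sub_cancel] at h2
  have h3 : mulOp (star (η : LInf) • ψ) (beurlingShift η h) =
      mulZ (mulOp (star (η : LInf) • ψ) h) := by
    rw [coe_beurlingShift]
    exact mulOp_comm _ _ _
  rwa [← h3] at h2

theorem exists_eq_restrictedToeplitz {η θ : InnerFunction} {A : beurling η →L[ℂ] modelSpace θ}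
    (hA : A ∘L beurlingShift η = compressedShift θ ∘L A) :
    ∃ φ ∈ conjMulHInf η, A = restrictedToeplitz η θ φ := by
  -- Transport `A` to `H²` along the isometry `f ↦ η f`.
  let B : L2 →L[ℂ] L2 :=
    (modelSpace θ).subtypeL ∘L A ∘L (beurling η).orthogonalProjectionOnto ∘L mulOp η
  have hB (f : L2) (hf : f ∈ H2) : B f = A ⟨mulOp η f, f, hf, rfl⟩ :=
    congrArg (fun h => (A h : L2))
      (Submodule.orthogonalProjectionOnto_mem_subspace_eq_self (K := beurling η)
        ⟨mulOp η f, f, hf, rfl⟩)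
  obtain ⟨ψ, hψ, h⟩ := exists_mulOp_sub_mem_beurling (θ := θ) (B := B) (fun f hf => by
      have hzf : mulZ f ∈ H2 := mulZPow_mem_H2 zero_le_one hf
      rw [hB _ hf, hB _ hzf]
      have h1 : (⟨mulOp η (mulZ f), mulZ f, hzf, rfl⟩ : beurling η) =
          beurlingShift η ⟨mulOp η f, f, hf, rfl⟩ := by
        apply Subtype.ext
        rw [coe_beurlingShift]
        exact mulOp_comm _ _ _
      have h2 : A (beurlingShift η ⟨mulOp η f, f, hf, rfl⟩) =
          compressedShift θ (A ⟨mulOp η f, f, hf, rfl⟩) := 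
        congrArg (fun T => T ⟨mulOp η f, f, hf, rfl⟩) hA
      rw [h1, h2, ← neg_sub]
      exact (beurling θ).neg_mem (mulZ_sub_compressedShift_mem_beurling _))
    (Submodule.coe_mem (A _)).1
  refine ⟨star (η : LInf) • ψ, ⟨ψ, hψ, rfl⟩, ?_⟩
  ext1 k
  obtain ⟨_, f, hf, rfl⟩ := k
  have h1 : mulOp (star (η : LInf) • ψ) (mulOp η f) - A ⟨mulOp η f, f, hf, rfl⟩ ∈ beurling θ := by
    rw [mulOp_conj_mul, ← hB f hf]
    exact h f hf
  exact (orthogonalProjectionOnto_modelSpace_eq h1).symm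

end RestrictedToeplitz

end

theorem mainTheorem3 (η θ : RestrictedToeplitz.InnerFunction)
    (A : RestrictedToeplitz.beurling η →L[ℂ] RestrictedToeplitz.modelSpace θ) :
    A ∘L RestrictedToeplitz.beurlingShift η = RestrictedToeplitz.compressedShift θ ∘L A ↔
      ∃ φ ∈ RestrictedToeplitz.conjMulHInf η,
        A = RestrictedToeplitz.restrictedToeplitz η θ φ := by
  refine ⟨RestrictedToeplitz.exists_eq_restrictedToeplitz, ?_⟩
  rintro ⟨φ, hφ, rfl⟩
  exact RestrictedToeplitz.restrictedToeplitz_comp_beurlingShift hφ
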